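/- **Setting.** For $0<p<1$ let $\theta_1(z)=2p^{1/4}\sin z\prod_{n\ge1}(1-p^{2n})(1-2p^{2n}\cos 2z+p^{4n})$, $\theta_2(z)=2p^{1/4}\cos z\prod_{n\ge1}(1-p^{2n})(1+2p^{2n}\cos 2z+p^{4n})$, $\theta_3(z)=\prod_{n\ge1}(1-p^{2n})(1+2p^{2n-1}\cos 2z+p^{4n-2})$, $\theta_4(z)=\prod_{n\ge1}(1-p^{2n})(1-2p^{2n-1}\cos 2z+p^{4n-2})$ be the Jacobi theta functions of nome $p$. Let $M\in\{0,1,2,\dots\}$ and let $u_1,\dots,u_4,v_1,\dots,v_4,u$ be real with $u_r>0$ and $|v_r|<u_r+\tfrac12$ for $r=1,2$. Put $\alpha=\pi/(u_1+u_2+M)$, suppose that $u,u+1\notin\frac{2\pi}{\alpha}\mathbb Z$, and set $$[z]_1=\frac{\theta_1(\frac\alpha2z)}{\frac\alpha2\theta_1'(0)},\qquad [z]_r=\frac{\theta_r(\frac\alpha2z)}{\theta_r(0)}\quad(r=2,3,4).$$ Let $\pi_1=\mathrm{id}$, $\pi_2=(12)(34)$, $\pi_3=(13)(24)$, $\pi_4=(14)(23)$,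 and $$A(z)=\prod_{r=1}^4\frac{[z+u_r]_r}{[z]_r}\frac{[z+\frac12+v_r]_r}{[z+\frac12]_r},\qquad B(z)=\sum_{r=1}^4c_r\frac{[z+\frac12+u]_r}{[z+\frac12]_r}\frac{[z-\frac12-u]_r}{[z-\frac12]_r},\qquad c_r=\frac{2}{[u]_1[u+1]_1}\prod_{s=1}^4[u_{\pi_r(s)}-\tfrac12]_s[v_{\pi_r(s)}]_s,$$ where a term of $B$ with $c_r=0$ is zero. Put $a_k=A(-u_1-k)$ and $\tilde a_k=A(u_1+M-k)$ for $1\le k\le M$, and $b_k=B(u_1+k)$ for $0\le k\le M$. Let $\mathbf H$ be the real tridiagonal $(M+1)\times(M+1)$ matrix, with rows and columns numbered $0,\dots,M$, whose only nonzero entries can be $\mathbf H_{k,k}=b_k$, $\mathbf H_{k,k-1}=a_k$ and $\mathbf H_{k,k+1}=\tilde a_{M-k}$. For $0\le k\le M+1$ let $p_k(E)$ be the determinant of the leading $k\times k$ block of $E\,\mathbf I-\mathbf H$ (so $p_0=1$). The normalized elliptic Racah polynomials and the weights are $$f_k(E)=p_k(E)\prod_{0\le j<k}\tilde a_{M-j}^{-1},\qquad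 \Delta_k=\prod_{1\le l\le k}\frac{\tilde a_{M+1-l}}{a_l}\qquad(0\le k\le M).$$ Let $\tilde p_M$ be the polynomial $p_M$ for the permuted parameters $(u_1,v_1)\leftrightarrow(u_2,v_2)$, $(u_3,v_3)\leftrightarrow(u_4,v_4)$. **Proposition (Orthogonality Relation).** The numbers $a_1,\dots,a_M,\tilde a_1,\dots,\tilde a_M$ are positive, and the spectrum of $\mathbf H$ consists of $M+1$ distinct real eigenvalues $E_0>E_1>\dots>E_M$. The numbers $\epsilon_j=\tilde p_M(E_j)/(a_1\cdots a_M)$ are nonzero, and for $0\le i,j\le M$ $$\sum_{k=0}^M f_k(E_i)f_k(E_j)\Delta_k=\begin{cases}N_j&\text{if } i=j,\\0&\text{if } i\ne j,\end{cases}$$ with $$N_j=\frac1{|\epsilon_j|\,a_1\cdots a_M}\prod_{\substack{0\le l\le M\\ l\ne j}}|E_j-E_l| =\frac1{|\epsilon_j|}\prod_{\substack{1\le k\le M\\1\le r\le4}}\frac{[u_1+k]_r}{[u_1-u_r+k]_r}\frac{[u_1-\frac12+k]_r}{[u_1-v_r-\frac12+k]_r}\prod_{\substack{0\le l\le M\\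 l\ne j}}|E_j-E_l| .$$ -/

import Mathlib

open scoped BigOperators

namespace EllipticRacah

noncomputable section

/-! Throughout, the index set `{1, 2, 3, 4}` is `Fin 4`, so the index `r` becomes `r - 1`. -/

/-- The Jacobi theta function `θ₁(z; p)` with nome `p`, for real arguments. -/
def theta1 (p z : ℝ) : ℝ :=
  2 * p ^ (1 / 4 : ℝ) * Real.sin z *
    ∏' n : ℕ, (1 - p ^ (2 * (n + 1))) *
      (1 - 2 * p ^ (2 * (n + 1)) * Real.cos (2 * z) + p ^ (4 * (n + 1)))

/-- The Jacobi theta function `θ₂(z; p)` with nome `p`, for real arguments. -/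
def theta2 (p z : ℝ) : ℝ :=
  2 * p ^ (1 / 4 : ℝ) * Real.cos z *
    ∏' n : ℕ, (1 - p ^ (2 * (n + 1))) *
      (1 + 2 * p ^ (2 * (n + 1)) * Real.cos (2 * z) + p ^ (4 * (n + 1)))

/-- The Jacobi theta function `θ₃(z; p)` with nome `p`, for real arguments. -/
def theta3 (p z : ℝ) : ℝ :=
  ∏' n : ℕ, (1 - p ^ (2 * (n + 1))) *
    (1 + 2 * p ^ (2 * n + 1) * Real.cos (2 * z) + p ^ (4 * n + 2))

/-- The Jacobi theta function `θ₄(z; p)` with nome `p`, for real arguments. -/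
def theta4 (p z : ℝ) : ℝ :=
  ∏' n : ℕ, (1 - p ^ (2 * (n + 1))) *
    (1 - 2 * p ^ (2 * n + 1) * Real.cos (2 * z) + p ^ (4 * n + 2))

/-- The permutations `π₁ = id`, `π₂ = (12)(34)`, `π₃ = (13)(24)`, `π₄ = (14)(23)`. -/
def perm : Fin 4 → Equiv.Perm (Fin 4) :=
  ![1, Equiv.swap 0 1 * Equiv.swap 2 3, Equiv.swap 0 2 * Equiv.swap 1 3,
    Equiv.swap 0 3 * Equiv.swap 1 2]

/-- The free parameters: the size `M`, the elliptic nome `p`, the coupling parameters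
`u₁, …, u₄` and `v₁, …, v₄`, and the virtual regularization parameter (called `w` here). -/
structure Parameters where
  M : ℕ
  p : ℝ
  u : Fin 4 → ℝ
  v : Fin 4 → ℝ
  w : ℝ

namespace Parameters

variable (P : Parameters)

/-- The scaling parameter `α = π / (u₁ + u₂ + M)`. -/
def alpha : ℝ := Real.pi / (P.u 0 + P.u 1 + P.M)

/-- The rescaled theta functions `[z]_r`. -/
def bracket (r : Fin 4) (z : ℝ) : ℝ :=
  ![theta1 P.p (P.alpha / 2 * z) / (P.alpha / 2 * deriv (theta1 P.p) 0),
    theta2 P.p (P.alpha / 2 * z) / theta2 P.p 0,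
    theta3 P.p (P.alpha / 2 * z) / theta3 P.p 0,
    theta4 P.p (P.alpha / 2 * z) / theta4 P.p 0] r

/-- The coefficient function `A(z)` of the difference Heun operator. -/
def coeffA (z : ℝ) : ℝ :=
  ∏ r : Fin 4, P.bracket r (z + P.u r) / P.bracket r z *
    (P.bracket r (z + 1 / 2 + P.v r) / P.bracket r (z + 1 / 2))

/-- The constants `c_r`. -/
def coeffC (r : Fin 4) : ℝ :=
  2 / (P.bracket 0 P.w * P.bracket 0 (P.w + 1)) *
    ∏ s : Fin 4, P.bracket s (P.u (perm r s) - 1 / 2) * P.bracket s (P.v (perm r s))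

/-- The coefficient function `B(z)` of the difference Heun operator. -/
def coeffB (z : ℝ) : ℝ :=
  ∑ r : Fin 4, P.coeffC r *
    (P.bracket r (z + 1 / 2 + P.w) / P.bracket r (z + 1 / 2)) *
    (P.bracket r (z - 1 / 2 - P.w) / P.bracket r (z - 1 / 2))

/-- `a_k = A(-u₁ - k)`. -/
def a (k : ℕ) : ℝ := P.coeffA (-P.u 0 - k)

/-- `ã_k = A(u₁ + M - k)`. -/
def aTilde (k : ℕ) : ℝ := P.coeffA (P.u 0 + P.M - k)

/-- `b_k = B(u₁ + k)`. -/
def b (k : ℕ) : ℝ := P.coeffB (P.u 0 + k)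

/-- The leading `n × n` block (`n ≤ M + 1`) of the tridiagonal matrix `H`: for rows and columns
numbered from `0`, row `i` holds `a_i`, `b_i`, `ã_{M-i}` in columns `i - 1`, `i`, `i + 1`. -/
def heunBlock (n : ℕ) : Matrix (Fin n) (Fin n) ℝ :=
  Matrix.of fun i j =>
    if (i : ℕ) = j then P.b i
    else if (i : ℕ) = j + 1 then P.a i
    else if (j : ℕ) = i + 1 then P.aTilde (P.M - i)
    else 0

/-- The `(M + 1) × (M + 1)` tridiagonal matrix `H`. -/
def heunMatrix : Matrix (Fin (P.M + 1)) (Fin (P.M + 1)) ℝ := P.heunBlock (P.M + 1)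

/-- The monic elliptic Racah polynomial `p_k`, `0 ≤ k ≤ M + 1`: the determinant of the leading
`k × k` block of `X - H`. -/
def racahPoly (k : ℕ) : Polynomial ℝ := (P.heunBlock k).charpoly

/-- The normalized elliptic Racah polynomial `f_k(x) = p_k(x) ∏_{0 ≤ j < k} ã_{M-j}⁻¹`. -/
def f (k : ℕ) (x : ℝ) : ℝ :=
  (P.racahPoly k).eval x * ∏ j ∈ Finset.range k, (P.aTilde (P.M - j))⁻¹

/-- The weights `Δ_k = ∏_{1 ≤ l ≤ k} ã_{M+1-l} / a_l`. -/
def weight (k : ℕ) : ℝ := ∏ l ∈ Finset.Icc 1 k, P.aTilde (P.M + 1 - l) / P.a l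

/-- The action of `π₂` on the coupling parameters:
`(u₁, v₁) ↔ (u₂, v₂)` and `(u₃, v₃) ↔ (u₄, v₄)`. -/
def swap : Parameters := { P with u := P.u ∘ perm 1, v := P.v ∘ perm 1 }

/-- `ε = p̃_M(x) / (a_1 ⋯ a_M)`, where `p̃_M` is `p_M` for the parameters permuted by `π₂`;
at `x = E_j` this is `ε_j`. -/
def eps (x : ℝ) : ℝ := (P.swap.racahPoly P.M).eval x / ∏ k ∈ Finset.Icc 1 P.M, P.a k

end Parameters

end

end EllipticRacah

/-! The half-period shift `z ↦ z + π / α` exchanges `θ₁` with `θ₂` and `θ₃` with `θ₄` up to a sign.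
Hence `ã_k` and the reversed diagonal of `H` are `a_k` and the diagonal of `H` for the parameters
permuted by `π₂`, and that permutation of the parameters reverses `H`. On the arguments that occur
in `a_k` all theta functions are positive, so `a_k` and `ã_k` are positive and `H` is similar to a
symmetric Jacobi matrix.

The left-hand side of the orthogonality relation is the Christoffel–Darboux kernel `K(E_i, E_j)`
of the polynomials `p_k`, so it is `p_{M+1}(E_i) p_M(E_j) / ((E_i - E_j) ∏ a_k ã_k)`, read as a
limit when `i = j`. By the reversal, `p̃_M` is the characteristic polynomial of `H` without its
first row and column, i.e. the polynomial associated with `p_M`, and the determinant identity for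
these two solutions of the recurrence says that `p_M p̃_M = ∏ a_k ã_k` at every zero of `p_{M+1}`.
Therefore `p̃_M(E_j) K(x, E_j) = ∏_{l ≠ j} (x - E_l)`. -/

namespace EllipticRacah

section InfiniteProduct

lemma tprod_one_add_pos {ι : Type*} {f : ι → ℝ} (hf : Summable f) (hpos : ∀ i, 0 < 1 + f i) :
    0 < ∏' i, (1 + f i) := by
  rw [← Real.rexp_tsum_eq_tprod hpos (Real.summable_log_one_add_of_summable hf)]
  exact Real.exp_pos _

lemma continuousOn_tprod_one_add {ι α A : Type*} [TopologicalSpace α] [NormedCommRing A]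
    [NormOneClass A] [CompleteSpace A] {f : ι → α → A} {u : ι → ℝ} {K : Set α} (hK : IsCompact K)
    (hu : Summable u) (hfu : ∀ i, ∀ x ∈ K, ‖f i x‖ ≤ u i) (hf : ∀ i, ContinuousOn (f i) K) :
    ContinuousOn (fun x => ∏' i, (1 + f i x)) K :=
  (hu.hasProdUniformlyOn_one_add hK (.of_forall hfu) hf).tendstoUniformlyOn.continuousOn
    (.of_forall fun s => continuousOn_finsetProd s fun i _ => continuousOn_const.add (hf i))

end InfiniteProduct

section ThetaProduct

/-- The infinite product common to the Jacobi theta functions of nome `p`: `θ₁` and `θ₂` have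
`e n = 2 * (n + 1)`, `θ₃` and `θ₄` have `e n = 2 * n + 1`, and `t = ± cos (2 * z)`. -/
noncomputable def thetaProduct (p : ℝ) (e : ℕ → ℕ) (t : ℝ) : ℝ :=
  ∏' n, (1 - p ^ (2 * (n + 1))) * (1 + 2 * p ^ e n * t + p ^ (2 * e n))

lemma one_add_two_mul_add_sq_pos {q t : ℝ} (hq0 : 0 ≤ q) (hq1 : q < 1) (ht : |t| ≤ 1) :
    0 < 1 + 2 * q * t + q ^ 2 := by
  nlinarith [neg_le_of_abs_le ht]

lemma abs_thetaFactor_sub_one_le {s q r t : ℝ} (hr0 : 0 ≤ r) (hr : r ≤ s) (hq0 : 0 ≤ q)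
    (hq : q ≤ s) (hs : s ≤ 1) (ht : |t| ≤ 1) :
    |(1 - r) * (1 + 2 * q * t + q ^ 2) - 1| ≤ 7 * s := by
  have h1 := neg_le_of_abs_le ht
  have h2 := le_of_abs_le ht
  have hlow : 0 ≤ 1 + 2 * q * t + q ^ 2 := by nlinarith
  have hup : 1 + 2 * q * t + q ^ 2 ≤ 4 := by nlinarith
  rw [abs_le]
  constructor <;> nlinarith

variable {p : ℝ} {e : ℕ → ℕ}

lemma thetaProduct_eq_tprod_one_add (t : ℝ) : thetaProduct p e t =
    ∏' n, (1 + ((1 - p ^ (2 * (n + 1))) * (1 + 2 * p ^ e n * t + p ^ (2 * e n)) - 1)) := by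
  simp only [thetaProduct, add_sub_cancel]

lemma abs_thetaProduct_factor_sub_one_le (hp0 : 0 ≤ p) (hp1 : p ≤ 1) (n : ℕ) (he : n ≤ e n) {t : ℝ}
    (ht : |t| ≤ 1) :
    |(1 - p ^ (2 * (n + 1))) * (1 + 2 * p ^ e n * t + p ^ (2 * e n)) - 1| ≤ 7 * p ^ n := by
  rw [mul_comm 2 (e n), pow_mul p (e n)]
  exact abs_thetaFactor_sub_one_le (by positivity) (pow_le_pow_of_le_one hp0 hp1 (by lia))
    (by positivity) (pow_le_pow_of_le_one hp0 hp1 he) (pow_le_one₀ hp0 hp1) ht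

lemma thetaProduct_pos (hp0 : 0 ≤ p) (hp1 : p < 1) (he : ∀ n, n < e n) {t : ℝ} (ht : |t| ≤ 1) :
    0 < thetaProduct p e t := by
  rw [thetaProduct_eq_tprod_one_add]
  refine tprod_one_add_pos (((summable_geometric_of_lt_one hp0 hp1).mul_left 7).of_norm_bounded
    fun n => abs_thetaProduct_factor_sub_one_le hp0 hp1.le n (he n).le ht) fun n => ?_
  rw [add_sub_cancel, mul_comm 2 (e n), pow_mul p (e n)]
  exact mul_pos (sub_pos.mpr (pow_lt_one₀ hp0 hp1 (by lia)))
    (one_add_two_mul_add_sq_pos (by positivity) (pow_lt_one₀ hp0 hp1 (Nat.ne_zero_of_lt (he n))) ht)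

lemma continuousOn_thetaProduct (hp0 : 0 ≤ p) (hp1 : p < 1) (he : ∀ n, n ≤ e n) :
    ContinuousOn (thetaProduct p e) (Set.Icc (-1) 1) := by
  refine (continuousOn_tprod_one_add isCompact_Icc
    ((summable_geometric_of_lt_one hp0 hp1).mul_left 7)
    (fun n t ht => abs_thetaProduct_factor_sub_one_le hp0 hp1.le n (he n) (abs_le.mpr ht))
    fun n => by fun_prop).congr fun t _ => thetaProduct_eq_tprod_one_add t

end ThetaProduct

section Theta

open Real

variable {p : ℝ}

lemma theta1_eq_thetaProduct (p z : ℝ) : theta1 p z =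
    2 * p ^ (1 / 4 : ℝ) * sin z * thetaProduct p (fun n => 2 * (n + 1)) (-cos (2 * z)) := by
  simp only [theta1, thetaProduct, mul_neg, ← sub_eq_add_neg, ← mul_assoc, Nat.reduceMul]

lemma theta2_eq_thetaProduct (p z : ℝ) : theta2 p z =
    2 * p ^ (1 / 4 : ℝ) * cos z * thetaProduct p (fun n => 2 * (n + 1)) (cos (2 * z)) := by
  simp only [theta2, thetaProduct, ← mul_assoc, Nat.reduceMul]

lemma theta3_eq_thetaProduct (p z : ℝ) :
    theta3 p z = thetaProduct p (fun n => 2 * n + 1) (cos (2 * z)) := by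
  simp only [theta3, thetaProduct, mul_add 2 (2 * _) 1, ← mul_assoc, Nat.reduceMul, mul_one]

lemma theta4_eq_thetaProduct (p z : ℝ) :
    theta4 p z = thetaProduct p (fun n => 2 * n + 1) (-cos (2 * z)) := by
  simp only [theta4, thetaProduct, mul_add 2 (2 * _) 1, mul_neg, ← sub_eq_add_neg, ← mul_assoc,
    Nat.reduceMul, mul_one]

lemma cos_two_mul_add_pi_div_two (z : ℝ) : cos (2 * (z + π / 2)) = -cos (2 * z) := by
  rw [mul_add, mul_div_cancel₀ π two_ne_zero, cos_add_pi]

lemma theta1_add_pi_div_two (p z : ℝ) : theta1 p (z + π / 2) = theta2 p z := by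
  rw [theta1_eq_thetaProduct, theta2_eq_thetaProduct, cos_two_mul_add_pi_div_two,
    sin_add_pi_div_two, neg_neg]

lemma theta2_add_pi_div_two (p z : ℝ) : theta2 p (z + π / 2) = -theta1 p z := by
  rw [theta1_eq_thetaProduct, theta2_eq_thetaProduct, cos_two_mul_add_pi_div_two,
    cos_add_pi_div_two, mul_neg, neg_mul]

lemma theta3_add_pi_div_two (p z : ℝ) : theta3 p (z + π / 2) = theta4 p z := by
  rw [theta3_eq_thetaProduct, theta4_eq_thetaProduct, cos_two_mul_add_pi_div_two]

lemma theta4_add_pi_div_two (p z : ℝ) : theta4 p (z + π / 2) = theta3 p z := by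
  rw [theta3_eq_thetaProduct, theta4_eq_thetaProduct, cos_two_mul_add_pi_div_two, neg_neg]

lemma theta1_neg (p z : ℝ) : theta1 p (-z) = -theta1 p z := by
  simp [theta1]

lemma theta2_neg (p z : ℝ) : theta2 p (-z) = theta2 p z := by
  simp [theta2]

lemma theta3_neg (p z : ℝ) : theta3 p (-z) = theta3 p z := by
  simp [theta3]

lemma theta4_neg (p z : ℝ) : theta4 p (-z) = theta4 p z := by
  simp [theta4]

lemma theta1_pos (hp0 : 0 < p) (hp1 : p < 1) {z : ℝ} (hz : z ∈ Set.Ioo 0 π) :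
    0 < theta1 p z := by
  have hsin := sin_pos_of_mem_Ioo hz
  have hprod := thetaProduct_pos hp0.le hp1 (e := fun n => 2 * (n + 1)) (fun n => by lia)
    ((abs_neg _).trans_le (abs_cos_le_one (2 * z)))
  rw [theta1_eq_thetaProduct]
  positivity

lemma theta2_pos (hp0 : 0 < p) (hp1 : p < 1) {z : ℝ} (hz : z ∈ Set.Ioo (-(π / 2)) (π / 2)) :
    0 < theta2 p z := by
  rw [← theta1_add_pi_div_two]
  exact theta1_pos hp0 hp1 ⟨by linarith [hz.1], by linarith [hz.2]⟩

lemma theta3_pos (hp0 : 0 ≤ p) (hp1 : p < 1) (z : ℝ) : 0 < theta3 p z := by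
  rw [theta3_eq_thetaProduct]
  exact thetaProduct_pos hp0 hp1 (fun n => by lia) (abs_cos_le_one _)

lemma theta4_pos (hp0 : 0 ≤ p) (hp1 : p < 1) (z : ℝ) : 0 < theta4 p z := by
  rw [← theta3_add_pi_div_two]
  exact theta3_pos hp0 hp1 _

lemma hasDerivAt_mul_of_eq_zero {𝕜 : Type*} [NontriviallyNormedField 𝕜] {f g : 𝕜 → 𝕜} {f' a : 𝕜}
    (hf : HasDerivAt f f' a) (h0 : f a = 0) (hg : ContinuousAt g a) :
    HasDerivAt (fun x => f x * g x) (f' * g a) a := by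
  rw [hasDerivAt_iff_tendsto_slope] at hf ⊢
  refine (hf.mul (hg.tendsto.mono_left nhdsWithin_le_nhds)).congr fun x => ?_
  simp only [slope_def_field, h0, zero_mul, sub_zero, div_mul_eq_mul_div]

lemma deriv_theta1_zero_pos (hp0 : 0 < p) (hp1 : p < 1) : 0 < deriv (theta1 p) 0 := by
  let g z := 2 * p ^ (1 / 4 : ℝ) * thetaProduct p (fun n => 2 * (n + 1)) (-cos (2 * z))
  have hcont : Continuous g :=
    continuous_const.mul <| (continuousOn_thetaProduct hp0.le hp1 fun n => by lia).comp_continuous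
      (by fun_prop) fun z => abs_le.mp ((abs_neg _).trans_le (abs_cos_le_one _))
  have htheta : theta1 p = fun z => sin z * g z := funext fun z => by
    rw [theta1_eq_thetaProduct, mul_right_comm, mul_comm]
  have hderiv := hasDerivAt_mul_of_eq_zero (hasDerivAt_sin 0) sin_zero hcont.continuousAt
  have hprod := thetaProduct_pos hp0.le hp1 (e := fun n => 2 * (n + 1)) (fun n => by lia)
    ((abs_neg _).trans_le (abs_cos_le_one (2 * 0)))
  rw [htheta, hderiv.deriv, cos_zero, one_mul]
  positivity

lemma perm_one_zero : perm 1 0 = 1 := by decide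

lemma perm_one_one : perm 1 1 = 0 := by decide

lemma perm_one_two : perm 1 2 = 3 := by decide

lemma perm_one_three : perm 1 3 = 2 := by decide

lemma perm_one_perm_one (r : Fin 4) : perm 1 (perm 1 r) = r := by
  revert r; decide

lemma perm_perm_one (r s : Fin 4) : perm (perm 1 r) s = perm 1 (perm r s) := by
  revert r s; decide

/-- The Jacobi theta functions `θ₁, …, θ₄` as a family. -/
noncomputable def theta (p : ℝ) (r : Fin 4) (z : ℝ) : ℝ :=
  ![theta1 p z, theta2 p z, theta3 p z, theta4 p z] r

lemma theta_div_theta_add_pi_div_two (p x y : ℝ) (r : Fin 4) :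
    theta p r (x + π / 2) / theta p r (y + π / 2) =
      theta p (perm 1 r) x / theta p (perm 1 r) y := by
  fin_cases r <;> simp [perm_one_zero, perm_one_one, perm_one_two, perm_one_three, theta,
    theta1_add_pi_div_two, theta2_add_pi_div_two, theta3_add_pi_div_two, theta4_add_pi_div_two,
    neg_div_neg_eq]

lemma theta_div_theta_neg (p x y : ℝ) (r : Fin 4) :
    theta p r (-x) / theta p r (-y) = theta p r x / theta p r y := by
  fin_cases r <;> simp [theta, theta1_neg, theta2_neg, theta3_neg, theta4_neg, neg_div_neg_eq]

end Theta

section Tridiagonal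

/-- The `n × n` tridiagonal matrix with lower, main and upper diagonals `l`, `d`, `u`. All three
sequences are indexed by rows, so `l 0` and `u (n - 1)` do not occur. -/
def tridiagonal {R : Type*} [Zero R] (l d u : ℕ → R) (n : ℕ) : Matrix (Fin n) (Fin n) R :=
  Matrix.of fun i j =>
    if (i : ℕ) = j then d i
    else if (i : ℕ) = j + 1 then l i
    else if (j : ℕ) = i + 1 then u i
    else 0

lemma submatrix_castSucc_tridiagonal {R : Type*} [Zero R] (l d u : ℕ → R) (n : ℕ) :
    (tridiagonal l d u (n + 1)).submatrix Fin.castSucc Fin.castSucc = tridiagonal l d u n :=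
  rfl

lemma isSymm_tridiagonal {R : Type*} [Zero R] (d e : ℕ → R) (n : ℕ) :
    (tridiagonal (fun i => e (i - 1)) d e n).IsSymm := by
  refine Matrix.IsSymm.ext fun i j => ?_
  simp only [tridiagonal, Matrix.of_apply]
  split_ifs <;> first | lia | simp_all

lemma det_eq_mul_det_of_last_column_eq_zero {R : Type*} [CommRing R] {n : ℕ}
    (A : Matrix (Fin (n + 1)) (Fin (n + 1)) R) (h : ∀ i : Fin n, A i.castSucc (Fin.last n) = 0) :
    A.det = A (Fin.last n) (Fin.last n) * (A.submatrix Fin.castSucc Fin.castSucc).det := by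
  rw [Matrix.det_succ_column A (Fin.last n), Fin.sum_univ_castSucc]
  simp [h, ← two_mul]

variable {R : Type*} [CommRing R] (l d u : ℕ → R) (n : ℕ)

lemma det_submatrix_succAbove_tridiagonal :
    ((tridiagonal l d u (n + 2)).submatrix Fin.castSucc (Fin.last n).castSucc.succAbove).det =
      u n * (tridiagonal l d u n).det := by
  have hcol (j : Fin n) : (Fin.last n).castSucc.succAbove j.castSucc = j.castSucc.castSucc :=
    Fin.succAbove_of_castSucc_lt _ _ (by simp [Fin.lt_def])
  rw [det_eq_mul_det_of_last_column_eq_zero]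
  · congr 1
    · simp [tridiagonal, show n ≠ n + 1 + 1 by lia]
    · congr 1
      ext i j
      simp [tridiagonal, hcol]
  · intro i
    have hi := i.isLt
    simp only [tridiagonal, Matrix.submatrix_apply, Matrix.of_apply,
      Fin.succAbove_castSucc_self, Fin.val_castSucc, Fin.val_succ, Fin.val_last]
    rw [if_neg (by lia), if_neg (by lia), if_neg (by lia)]

lemma det_tridiagonal_succ_succ :
    (tridiagonal l d u (n + 2)).det =
      d (n + 1) * (tridiagonal l d u (n + 1)).det -
        l (n + 1) * u n * (tridiagonal l d u n).det := by
  have hrow (j : Fin n) : tridiagonal l d u (n + 2) (Fin.last (n + 1)) j.castSucc.castSucc = 0 := by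
    have hj := j.isLt
    simp only [tridiagonal, Matrix.of_apply, Fin.val_castSucc, Fin.val_last]
    rw [if_neg (by lia), if_neg (by lia), if_neg (by lia)]
  have hsub : tridiagonal l d u (n + 2) (Fin.last (n + 1)) (Fin.last n).castSucc = l (n + 1) := by
    simp [tridiagonal]
  have hdiag : tridiagonal l d u (n + 2) (Fin.last (n + 1)) (Fin.last (n + 1)) = d (n + 1) := by
    simp [tridiagonal]
  rw [Matrix.det_succ_row _ (Fin.last (n + 1)), Fin.sum_univ_castSucc, Fin.sum_univ_castSucc,
    Fin.succAbove_last, det_submatrix_succAbove_tridiagonal, submatrix_castSucc_tridiagonal,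
    hsub, hdiag]
  simp only [hrow, mul_zero, zero_mul, Finset.sum_const_zero, zero_add, Fin.val_last,
    Fin.val_castSucc, ← two_mul, pow_mul, add_right_comm n 1 n, pow_succ, neg_one_sq, one_pow]
  ring

end Tridiagonal

section OrthPoly

open Polynomial

variable {R : Type*} [CommRing R]

/-- The monic polynomials `pₙ` of a three-term recurrence with diagonal coefficients `d` and
off-diagonal coefficients `β`. By Favard's theorem they are the monic orthogonal polynomials when
`β` is positive, whence the name. -/
noncomputable def orthPoly (d β : ℕ → R) : ℕ → R[X]
  | 0 => 1
  | 1 => X - C (d 0)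
  | n + 2 => (X - C (d (n + 1))) * orthPoly d β (n + 1) - C (β n) * orthPoly d β n

/-- The associated polynomials (numerator polynomials, polynomials of the second kind), which
satisfy the recurrence with all the coefficients shifted by one. -/
noncomputable def assocPoly (d β : ℕ → R) (n : ℕ) : R[X] :=
  orthPoly (fun i => d (i + 1)) (fun i => β (i + 1)) n

variable (d β : ℕ → R)

lemma orthPoly_succ_succ (n : ℕ) : orthPoly d β (n + 2) =
    (X - C (d (n + 1))) * orthPoly d β (n + 1) - C (β n) * orthPoly d β n := by
  rw [orthPoly]

variable {d β} in
lemma orthPoly_congr {β' : ℕ → R} {n : ℕ} (h : ∀ i, i + 1 < n → β i = β' i) :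
    orthPoly d β n = orthPoly d β' n := by
  induction n using Nat.twoStepInduction with
  | zero => rfl
  | one => rfl
  | more n ih₀ ih₁ =>
    rw [orthPoly_succ_succ, orthPoly_succ_succ, h n (by lia), ih₁ fun i hi => h i (by lia),
      ih₀ fun i hi => h i (by lia)]

lemma charmatrix_tridiagonal (l d u : ℕ → R) (n : ℕ) : (tridiagonal l d u n).charmatrix =
    tridiagonal (fun i => -C (l i)) (fun i => X - C (d i)) (fun i => -C (u i)) n := by
  ext1 i j
  rcases eq_or_ne i j with rfl | hij
  · simp [tridiagonal]
  · rw [Matrix.charmatrix_apply_ne _ _ _ hij]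
    simp only [tridiagonal, Matrix.of_apply, if_neg (Fin.val_ne_of_ne hij)]
    split_ifs <;> simp

theorem charpoly_tridiagonal (l d u : ℕ → R) (n : ℕ) :
    (tridiagonal l d u n).charpoly = orthPoly d (fun i => l (i + 1) * u i) n := by
  rw [Matrix.charpoly, charmatrix_tridiagonal]
  induction n using Nat.twoStepInduction with
  | zero => simp [orthPoly]
  | one => simp [orthPoly, tridiagonal]
  | more n ih₀ ih₁ =>
    rw [det_tridiagonal_succ_succ, orthPoly_succ_succ, ih₀, ih₁, neg_mul_neg, C_mul]

variable {d β} in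
/-- Conjugation with the antidiagonal permutation matrix reverses a tridiagonal matrix. -/
lemma orthPoly_eq_of_reverse {d' β' : ℕ → R} {n : ℕ} (hd : ∀ i j, i + j + 1 = n → d' i = d j)
    (hβ : ∀ i j, i + j + 2 = n → β' i = β j) : orthPoly d' β' n = orthPoly d β n := by
  have hrev : Matrix.reindex Fin.revPerm Fin.revPerm (tridiagonal 1 d' β' n) =
      tridiagonal (fun i => β (i - 1)) d 1 n := by
    ext i j
    have hi := i.isLt
    have hj := j.isLt
    simp only [tridiagonal, Matrix.reindex_apply, Matrix.submatrix_apply, Matrix.of_apply,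
      Fin.revPerm_symm, Fin.revPerm_apply, Fin.val_rev, Pi.one_apply]
    split_ifs <;> first | lia | skip
    · exact hd _ _ (by lia)
    · exact hβ _ _ (by lia)
  have h := Matrix.charpoly_reindex Fin.revPerm (tridiagonal 1 d' β' n)
  rw [hrev, charpoly_tridiagonal, charpoly_tridiagonal] at h
  simpa using h.symm

lemma orthPoly_mul_assocPoly_sub (n : ℕ) :
    orthPoly d β (n + 1) * assocPoly d β (n + 1) - orthPoly d β (n + 2) * assocPoly d β n =
      ∏ i ∈ Finset.range (n + 1), C (β i) := by
  induction n with
  | zero =>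
    simp only [assocPoly, orthPoly, zero_add, Finset.prod_range_one]
    ring
  | succ n ih =>
    rw [Finset.prod_range_succ, ← ih, orthPoly_succ_succ d β (n + 1)]
    simp only [assocPoly, orthPoly_succ_succ _ _ n]
    ring

variable {d β} in
lemma eval_orthPoly_mul_eval_assocPoly {n : ℕ} {x : R} (hx : (orthPoly d β (n + 1)).eval x = 0) :
    (orthPoly d β n).eval x * (assocPoly d β n).eval x = ∏ i ∈ Finset.range n, β i := by
  rcases n with _ | n
  · simp [assocPoly, orthPoly]
  · have h := congrArg (eval x) (orthPoly_mul_assocPoly_sub d β n)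
    simpa [eval_prod, hx] using h

variable {d β} in
lemma eval_assocPoly_ne_zero [IsDomain R] {n : ℕ} (hβ : ∀ i < n, β i ≠ 0) {x : R}
    (hx : (orthPoly d β (n + 1)).eval x = 0) : (assocPoly d β n).eval x ≠ 0 := by
  refine right_ne_zero_of_mul (a := (orthPoly d β n).eval x) ?_
  rw [eval_orthPoly_mul_eval_assocPoly hx]
  exact Finset.prod_ne_zero_iff.mpr fun i hi => hβ i (Finset.mem_range.mp hi)

end OrthPoly

section ChristoffelDarboux

open Polynomial Lagrange

variable {K : Type*} [Field K]

/-- The Christoffel–Darboux kernel `∑ k ≤ n, p_k(X) p_k(y) / h_k`, where `h_k = β 0 ⋯ β (k - 1)` is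
the squared norm of `p_k`. -/
noncomputable def christoffelKernel (d β : ℕ → K) (n : ℕ) (y : K) : K[X] :=
  ∑ k ∈ Finset.range (n + 1),
    C ((orthPoly d β k).eval y / ∏ i ∈ Finset.range k, β i) * orthPoly d β k

variable {d β : ℕ → K} {n : ℕ}

theorem christoffel_darboux (hβ : ∀ i < n, β i ≠ 0) (y : K) :
    (X - C y) * christoffelKernel d β n y = C (∏ i ∈ Finset.range n, β i)⁻¹ *
      (orthPoly d β (n + 1) * C ((orthPoly d β n).eval y) -
        orthPoly d β n * C ((orthPoly d β (n + 1)).eval y)) := by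
  induction n with
  | zero => simp [christoffelKernel, orthPoly]
  | succ n ih =>
    have hinv : C (∏ i ∈ Finset.range n, β i)⁻¹ =
        C (∏ i ∈ Finset.range (n + 1), β i)⁻¹ * C (β n) := by
      rw [Finset.prod_range_succ, ← C_mul, mul_inv, inv_mul_cancel_right₀ (hβ n n.lt_succ_self)]
    have hsucc : christoffelKernel d β (n + 1) y = christoffelKernel d β n y +
        C ((orthPoly d β (n + 1)).eval y / ∏ i ∈ Finset.range (n + 1), β i) *
          orthPoly d β (n + 1) := Finset.sum_range_succ _ _
    rw [hsucc, mul_add, ih fun i hi => hβ i (by lia), hinv, orthPoly_succ_succ, div_eq_mul_inv]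
    simp only [eval_sub, eval_mul, eval_X, eval_C, C_mul, C_sub]
    ring

lemma C_eval_assocPoly_mul_christoffelKernel {ι : Type*} [Fintype ι] [DecidableEq ι] {E : ι → K}
    (hβ : ∀ i < n, β i ≠ 0) (hE : orthPoly d β (n + 1) = nodal Finset.univ E) (j : ι) :
    C ((assocPoly d β n).eval (E j)) * christoffelKernel d β n (E j) =
      nodal (Finset.univ.erase j) E := by
  have hroot : (orthPoly d β (n + 1)).eval (E j) = 0 := by
    rw [hE, eval_nodal_at_node (Finset.mem_univ j)]
  have hprod : ∏ i ∈ Finset.range n, β i ≠ 0 :=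
    Finset.prod_ne_zero_iff.mpr fun i hi => hβ i (Finset.mem_range.mp hi)
  have hcancel : C (∏ i ∈ Finset.range n, β i)⁻¹ *
      (C ((orthPoly d β n).eval (E j)) * C ((assocPoly d β n).eval (E j))) = 1 := by
    rw [← C_mul, ← C_mul, eval_orthPoly_mul_eval_assocPoly hroot, inv_mul_cancel₀ hprod, C_1]
  refine mul_left_cancel₀ (X_sub_C_ne_zero (E j)) ?_
  rw [← nodal_eq_mul_nodal_erase (Finset.mem_univ j), ← hE, mul_left_comm,
    christoffel_darboux hβ, hroot, C_0, mul_zero, sub_zero]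
  linear_combination orthPoly d β (n + 1) * hcancel

end ChristoffelDarboux

section Real

open Polynomial Lagrange

variable {d β : ℕ → ℝ} {n : ℕ}

lemma eval_christoffelKernel_self_pos (hβ : ∀ i < n, 0 < β i) (y : ℝ) :
    0 < (christoffelKernel d β n y).eval y := by
  have hpos (k : ℕ) (hk : k ∈ Finset.range (n + 1)) : 0 < ∏ i ∈ Finset.range k, β i :=
    Finset.prod_pos fun i hi => hβ i (by grind)
  simp only [christoffelKernel, eval_finsetSum, eval_mul, eval_C, div_mul_eq_mul_div, ← sq]
  exact Finset.sum_pos' (fun k hk => div_nonneg (sq_nonneg _) (hpos k hk).le)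
    ⟨0, by simp, by simp [orthPoly]⟩

lemma exists_antitone_orthPoly_eq_nodal (hβ : ∀ i < n, 0 ≤ β i) :
    ∃ E : Fin (n + 1) → ℝ, Antitone E ∧ orthPoly d β (n + 1) = nodal Finset.univ E := by
  have hA := Matrix.isHermitian_iff_isSymm.mpr (isSymm_tridiagonal d (fun i => √(β i)) (n + 1))
  let σ := Tuple.sort (OrderDual.toDual ∘ hA.eigenvalues)
  refine ⟨hA.eigenvalues ∘ σ, Tuple.monotone_sort (OrderDual.toDual ∘ hA.eigenvalues), ?_⟩
  calc orthPoly d β (n + 1)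
      = orthPoly d (fun i => √(β (i + 1 - 1)) * √(β i)) (n + 1) :=
        orthPoly_congr fun i hi => (Real.mul_self_sqrt (hβ i (by lia))).symm
    _ = nodal Finset.univ hA.eigenvalues :=
        (charpoly_tridiagonal _ d _ _).symm.trans hA.charpoly_eq
    _ = nodal Finset.univ (hA.eigenvalues ∘ σ) :=
        (Equiv.prod_comp σ fun j => X - C (hA.eigenvalues j)).symm

/-- At a multiple zero the kernel, which is positive on the diagonal, would vanish. -/
theorem exists_strictAnti_orthPoly_eq_nodal (hβ : ∀ i < n, 0 < β i) :
    ∃ E : Fin (n + 1) → ℝ, StrictAnti E ∧ orthPoly d β (n + 1) = nodal Finset.univ E := by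
  obtain ⟨E, hanti, hE⟩ := exists_antitone_orthPoly_eq_nodal fun i hi => (hβ i hi).le
  refine ⟨E, hanti.strictAnti_of_injective fun i j hij => ?_, hE⟩
  by_contra hne
  have h := congrArg (eval (E j)) (C_eval_assocPoly_mul_christoffelKernel
    (fun i hi => (hβ i hi).ne') hE j)
  have hnodal : (nodal (Finset.univ.erase j) E).eval (E j) = 0 := by
    rw [← hij]
    exact eval_nodal_at_node (by simp [hne])
  have hassoc : (assocPoly d β n).eval (E j) ≠ 0 := eval_assocPoly_ne_zero
    (fun i hi => (hβ i hi).ne') (hE ▸ eval_nodal_at_node (Finset.mem_univ j))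
  rw [eval_mul, eval_C, hnodal] at h
  exact mul_ne_zero hassoc (eval_christoffelKernel_self_pos hβ _).ne' h

end Real

lemma spectrum_eq_range_of_charpoly_eq_nodal {K n ι : Type*} [Field K] [Fintype n] [DecidableEq n]
    [Fintype ι] {A : Matrix n n K} {E : ι → K} (hE : A.charpoly = Lagrange.nodal Finset.univ E) :
    spectrum K A = Set.range E := by
  ext x
  rw [Matrix.mem_spectrum_iff_isRoot_charpoly, hE, Polynomial.IsRoot.def, Lagrange.eval_nodal,
    Finset.prod_eq_zero_iff]
  simp only [Finset.mem_univ, true_and, sub_eq_zero, Set.mem_range, eq_comm]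

namespace Parameters

section Swap

variable (P : Parameters)

lemma swap_M : P.swap.M = P.M := rfl

lemma swap_w : P.swap.w = P.w := rfl

lemma swap_u (r : Fin 4) : P.swap.u r = P.u (perm 1 r) := rfl

lemma swap_v (r : Fin 4) : P.swap.v r = P.v (perm 1 r) := rfl

lemma swap_swap : P.swap.swap = P := by
  simp only [swap, Function.comp_def, perm_one_perm_one]

lemma swap_alpha : P.swap.alpha = P.alpha := by
  simp only [alpha, swap_M, swap_u, perm_one_zero, perm_one_one, add_comm (P.u 1)]

lemma swap_bracket (r : Fin 4) (z : ℝ) : P.swap.bracket r z = P.bracket r z := by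
  simp only [bracket, swap_alpha]
  rfl

lemma swap_coeffC (r : Fin 4) : P.swap.coeffC r = P.coeffC (perm 1 r) := by
  simp only [coeffC, swap_bracket, swap_w, swap_u, swap_v, perm_perm_one]

lemma pi_div_alpha : Real.pi / P.alpha = P.u 0 + P.u 1 + P.M :=
  div_div_cancel₀ Real.pi_ne_zero

end Swap

/-- The admissible domain of the nome and the coupling parameters. -/
structure Admissible (P : Parameters) : Prop where
  p_pos : 0 < P.p
  p_lt_one : P.p < 1
  u_zero_pos : 0 < P.u 0
  u_one_pos : 0 < P.u 1
  abs_v_zero_lt : |P.v 0| < P.u 0 + 1 / 2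
  abs_v_one_lt : |P.v 1| < P.u 1 + 1 / 2

namespace Admissible

variable {P : Parameters} (hP : P.Admissible)
include hP

lemma swap : P.swap.Admissible where
  p_pos := hP.p_pos
  p_lt_one := hP.p_lt_one
  u_zero_pos := hP.u_one_pos
  u_one_pos := hP.u_zero_pos
  abs_v_zero_lt := hP.abs_v_one_lt
  abs_v_one_lt := hP.abs_v_zero_lt

lemma period_pos : 0 < P.u 0 + P.u 1 + P.M :=
  add_pos_of_pos_of_nonneg (add_pos hP.u_zero_pos hP.u_one_pos) P.M.cast_nonneg

lemma alpha_pos : 0 < P.alpha := div_pos Real.pi_pos hP.period_pos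

lemma alpha_mul_period : P.alpha * (P.u 0 + P.u 1 + P.M) = Real.pi :=
  div_mul_cancel₀ _ hP.period_pos.ne'

lemma exists_bracket_eq_theta_div (r : Fin 4) :
    ∃ c : ℝ, 0 < c ∧ ∀ z, P.bracket r z = theta P.p r (P.alpha / 2 * z) / c := by
  have hπ := Real.pi_pos
  match r with
  | 0 => exact ⟨_, mul_pos (half_pos hP.alpha_pos) (deriv_theta1_zero_pos hP.p_pos hP.p_lt_one),
      fun z => rfl⟩
  | 1 => exact ⟨_, theta2_pos hP.p_pos hP.p_lt_one ⟨by linarith, by linarith⟩, fun z => rfl⟩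
  | 2 => exact ⟨_, theta3_pos hP.p_pos.le hP.p_lt_one 0, fun z => rfl⟩
  | 3 => exact ⟨_, theta4_pos hP.p_pos.le hP.p_lt_one 0, fun z => rfl⟩

lemma bracket_div_bracket (r : Fin 4) (x y : ℝ) : P.bracket r x / P.bracket r y =
    theta P.p r (P.alpha / 2 * x) / theta P.p r (P.alpha / 2 * y) := by
  obtain ⟨c, hc, h⟩ := hP.exists_bracket_eq_theta_div r
  rw [h, h, div_div_div_cancel_right₀ hc.ne']

lemma bracket_div_bracket_neg (r : Fin 4) (x y : ℝ) :
    P.bracket r (-x) / P.bracket r (-y) = P.bracket r x / P.bracket r y := by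
  rw [hP.bracket_div_bracket, hP.bracket_div_bracket, mul_neg, mul_neg, theta_div_theta_neg]

lemma bracket_div_bracket_add_half_period (r : Fin 4) (x y : ℝ) :
    P.bracket r (x + Real.pi / P.alpha) / P.bracket r (y + Real.pi / P.alpha) =
      P.bracket (perm 1 r) x / P.bracket (perm 1 r) y := by
  have hshift : P.alpha / 2 * (Real.pi / P.alpha) = Real.pi / 2 := by
    have := hP.alpha_pos.ne'
    field_simp
  rw [hP.bracket_div_bracket, hP.bracket_div_bracket, mul_add, mul_add, hshift,
    theta_div_theta_add_pi_div_two]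

lemma coeffA_add_half_period (z : ℝ) : P.coeffA (z + Real.pi / P.alpha) = P.swap.coeffA z := by
  rw [coeffA, coeffA, ← Equiv.prod_comp (perm 1)]
  refine Finset.prod_congr rfl fun r _ => ?_
  simp only [swap_bracket, swap_u, swap_v, perm_one_perm_one, add_right_comm z (Real.pi / P.alpha),
    add_right_comm (z + 1 / 2) (Real.pi / P.alpha), hP.bracket_div_bracket_add_half_period]

lemma coeffB_add_half_period (z : ℝ) : P.coeffB (z + Real.pi / P.alpha) = P.swap.coeffB z := by
  rw [coeffB, coeffB, ← Equiv.sum_comp (perm 1)]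
  refine Finset.sum_congr rfl fun r _ => ?_
  simp only [swap_bracket, swap_coeffC, swap_w, perm_one_perm_one,
    add_right_comm _ (Real.pi / P.alpha), add_sub_right_comm _ (Real.pi / P.alpha),
    hP.bracket_div_bracket_add_half_period]

lemma coeffB_neg (z : ℝ) : P.coeffB (-z) = P.coeffB z := by
  refine Finset.sum_congr rfl fun r _ => ?_
  rw [show -z + 1 / 2 + P.w = -(z - 1 / 2 - P.w) by ring,
    show -z - 1 / 2 - P.w = -(z + 1 / 2 + P.w) by ring,
    show -z + 1 / 2 = -(z - 1 / 2) by ring, show -z - 1 / 2 = -(z + 1 / 2) by ring,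
    hP.bracket_div_bracket_neg, hP.bracket_div_bracket_neg, mul_right_comm]

lemma aTilde_eq_swap_a (k : ℕ) : P.aTilde k = P.swap.a k := by
  rw [aTilde, Parameters.a, ← hP.coeffA_add_half_period, pi_div_alpha]
  congr 1
  simp only [swap_u, perm_one_zero]
  ring

lemma swap_aTilde (k : ℕ) : P.swap.aTilde k = P.a k := by
  rw [hP.swap.aTilde_eq_swap_a, swap_swap]

lemma swap_b {i j : ℕ} (h : i + j = P.M) : P.swap.b i = P.b j := by
  rw [Parameters.b, Parameters.b, ← hP.swap.coeffB_neg, ← hP.coeffB_add_half_period, pi_div_alpha,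
    ← h]
  congr 1
  simp only [swap_u, perm_one_zero]
  push_cast
  ring

lemma a_eq_prod (k : ℕ) : P.a k = ∏ r : Fin 4,
    P.bracket r (P.u 0 - P.u r + k) / P.bracket r (P.u 0 + k) *
      (P.bracket r (P.u 0 - P.v r - 1 / 2 + k) / P.bracket r (P.u 0 - 1 / 2 + k)) := by
  rw [Parameters.a, coeffA]
  refine Finset.prod_congr rfl fun r _ => ?_
  rw [← hP.bracket_div_bracket_neg r (P.u 0 - P.u r + k),
    ← hP.bracket_div_bracket_neg r (P.u 0 - P.v r - 1 / 2 + k)]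
  ring_nf

lemma prod_bracket_eq_inv_prod_a :
    ∏ k ∈ Finset.Icc 1 P.M, ∏ r : Fin 4,
      P.bracket r (P.u 0 + k) / P.bracket r (P.u 0 - P.u r + k) *
        (P.bracket r (P.u 0 - 1 / 2 + k) / P.bracket r (P.u 0 - P.v r - 1 / 2 + k)) =
      (∏ k ∈ Finset.Icc 1 P.M, P.a k)⁻¹ := by
  simp only [hP.a_eq_prod, ← Finset.prod_inv_distrib, mul_inv, inv_div]

lemma bracket_pos_of_theta_pos {r : Fin 4} {z : ℝ} (h : 0 < theta P.p r (P.alpha / 2 * z)) :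
    0 < P.bracket r z := by
  obtain ⟨c, hc, hb⟩ := hP.exists_bracket_eq_theta_div r
  rw [hb]
  exact div_pos h hc

lemma bracket_zero_pos {z : ℝ} (h0 : 0 < z) (h1 : z < 2 * (P.u 0 + P.u 1 + P.M)) :
    0 < P.bracket 0 z := by
  have hα := hP.alpha_pos
  have hperiod := hP.alpha_mul_period
  exact hP.bracket_pos_of_theta_pos
    (theta1_pos hP.p_pos hP.p_lt_one ⟨by positivity, by nlinarith⟩)

lemma bracket_one_pos {z : ℝ} (hz : |z| < P.u 0 + P.u 1 + P.M) : 0 < P.bracket 1 z := by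
  obtain ⟨h0, h1⟩ := abs_lt.mp hz
  have hα := hP.alpha_pos
  have hperiod := hP.alpha_mul_period
  exact hP.bracket_pos_of_theta_pos
    (theta2_pos hP.p_pos hP.p_lt_one ⟨by nlinarith, by nlinarith⟩)

lemma bracket_two_pos (z : ℝ) : 0 < P.bracket 2 z :=
  hP.bracket_pos_of_theta_pos (theta3_pos hP.p_pos.le hP.p_lt_one _)

lemma bracket_three_pos (z : ℝ) : 0 < P.bracket 3 z :=
  hP.bracket_pos_of_theta_pos (theta4_pos hP.p_pos.le hP.p_lt_one _)

lemma a_pos {k : ℕ} (hk : k ∈ Finset.Icc 1 P.M) : 0 < P.a k := by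
  obtain ⟨hk1, hkM⟩ := Finset.mem_Icc.mp hk
  have hk1' : (1 : ℝ) ≤ k := by exact_mod_cast hk1
  have hkM' : (k : ℝ) ≤ P.M := by exact_mod_cast hkM
  have hu0 := hP.u_zero_pos
  have hu1 := hP.u_one_pos
  have hv0 := abs_lt.mp hP.abs_v_zero_lt
  have hv1 := abs_lt.mp hP.abs_v_one_lt
  rw [hP.a_eq_prod, Fin.prod_univ_four]
  refine mul_pos (mul_pos (mul_pos ?_ ?_) ?_) ?_ <;>
    refine mul_pos (div_pos ?_ ?_) (div_pos ?_ ?_)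
  iterate 4 exact hP.bracket_zero_pos (by linarith) (by linarith)
  iterate 4 exact hP.bracket_one_pos (abs_lt.mpr ⟨by linarith, by linarith⟩)
  iterate 4 exact hP.bracket_two_pos _
  iterate 4 exact hP.bracket_three_pos _

lemma aTilde_pos {k : ℕ} (hk : k ∈ Finset.Icc 1 P.M) : 0 < P.aTilde k := by
  rw [hP.aTilde_eq_swap_a]
  exact hP.swap.a_pos hk

lemma prod_a_pos : 0 < ∏ k ∈ Finset.Icc 1 P.M, P.a k :=
  Finset.prod_pos fun _ hk => hP.a_pos hk

end Admissible

open Lagrange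

/-- The coefficients `H_{i+1,i} H_{i,i+1} = a_{i+1} ã_{M-i}` of the three-term recurrence of the
elliptic Racah polynomials. -/
noncomputable def offDiag (P : Parameters) (i : ℕ) : ℝ := P.a (i + 1) * P.aTilde (P.M - i)

section Recurrence

variable (P : Parameters)

lemma racahPoly_eq_orthPoly (n : ℕ) : P.racahPoly n = orthPoly P.b P.offDiag n :=
  charpoly_tridiagonal P.a P.b (fun i => P.aTilde (P.M - i)) n

lemma weight_eq_prod_range (k : ℕ) :
    P.weight k = ∏ i ∈ Finset.range k, P.aTilde (P.M - i) / P.a (i + 1) := by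
  rw [weight, ← Finset.Ico_add_one_right_eq_Icc, Finset.prod_Ico_eq_prod_range, Nat.add_sub_cancel]
  exact Finset.prod_congr rfl fun i _ => by rw [add_comm 1 i, Nat.add_sub_add_right]

end Recurrence

namespace Admissible

variable {P : Parameters} (hP : P.Admissible)
include hP

lemma offDiag_pos {i : ℕ} (hi : i < P.M) : 0 < P.offDiag i :=
  mul_pos (hP.a_pos (Finset.mem_Icc.mpr (by lia))) (hP.aTilde_pos (Finset.mem_Icc.mpr (by lia)))

lemma swap_offDiag {i j : ℕ} (h : i + j + 1 = P.M) : P.swap.offDiag i = P.offDiag j := by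
  rw [offDiag, offDiag, swap_M, hP.swap_aTilde, ← hP.aTilde_eq_swap_a, mul_comm,
    show P.M - i = j + 1 by lia, show P.M - j = i + 1 by lia]

/-- The swap reverses `H`, so its leading principal block of size `M` is the reversed trailing block
of `H`. -/
lemma swap_racahPoly_eq_assocPoly : P.swap.racahPoly P.M = assocPoly P.b P.offDiag P.M := by
  rw [racahPoly_eq_orthPoly, assocPoly]
  exact orthPoly_eq_of_reverse (fun i j h => hP.swap_b (by lia)) fun i j h => hP.swap_offDiag h

lemma f_mul_f_mul_weight (x y : ℝ) {k : ℕ} (hk : k ≤ P.M) : P.f k x * P.f k y * P.weight k =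
    (P.racahPoly k).eval y / (∏ i ∈ Finset.range k, P.offDiag i) * (P.racahPoly k).eval x := by
  have hprod : (∏ i ∈ Finset.range k, (P.aTilde (P.M - i))⁻¹) ^ 2 * P.weight k =
      (∏ i ∈ Finset.range k, P.offDiag i)⁻¹ := by
    rw [weight_eq_prod_range, ← Finset.prod_pow, ← Finset.prod_mul_distrib,
      ← Finset.prod_inv_distrib]
    refine Finset.prod_congr rfl fun i hi => ?_
    have hne : P.aTilde (P.M - i) ≠ 0 := right_ne_zero_of_mul
      (hP.offDiag_pos ((Finset.mem_range.mp hi).trans_le hk)).ne'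
    rw [offDiag]
    field_simp
  rw [f, f, div_eq_mul_inv, ← hprod]
  ring

lemma sum_f_mul_f_mul_weight (x y : ℝ) :
    ∑ k ∈ Finset.range (P.M + 1), P.f k x * P.f k y * P.weight k =
      (christoffelKernel P.b P.offDiag P.M y).eval x := by
  rw [christoffelKernel, Polynomial.eval_finsetSum]
  refine Finset.sum_congr rfl fun k hk => ?_
  rw [hP.f_mul_f_mul_weight x y (Finset.mem_range_succ_iff.mp hk), racahPoly_eq_orthPoly,
    Polynomial.eval_mul, Polynomial.eval_C]

lemma exists_strictAnti_racahPoly_eq_nodal : ∃ E : Fin (P.M + 1) → ℝ,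
    StrictAnti E ∧ P.racahPoly (P.M + 1) = nodal Finset.univ E := by
  rw [racahPoly_eq_orthPoly]
  exact exists_strictAnti_orthPoly_eq_nodal fun i hi => hP.offDiag_pos hi

lemma abs_eps_mul_prod_a (x : ℝ) :
    |P.eps x| * ∏ k ∈ Finset.Icc 1 P.M, P.a k = |(P.swap.racahPoly P.M).eval x| := by
  rw [eps, abs_div, abs_of_pos hP.prod_a_pos, div_mul_cancel₀ _ hP.prod_a_pos.ne']

variable {ι : Type*} [Fintype ι] {E : ι → ℝ}
  (hE : P.racahPoly (P.M + 1) = nodal Finset.univ E)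
include hE

lemma eval_swap_racahPoly_ne_zero (j : ι) : (P.swap.racahPoly P.M).eval (E j) ≠ 0 := by
  rw [racahPoly_eq_orthPoly] at hE
  rw [hP.swap_racahPoly_eq_assocPoly]
  exact eval_assocPoly_ne_zero (fun i hi => (hP.offDiag_pos hi).ne')
    (hE ▸ eval_nodal_at_node (Finset.mem_univ j))

lemma eps_ne_zero (j : ι) : P.eps (E j) ≠ 0 :=
  div_ne_zero (hP.eval_swap_racahPoly_ne_zero hE j) hP.prod_a_pos.ne'

lemma eval_swap_racahPoly_mul_sum [DecidableEq ι] (j : ι) (x : ℝ) :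
    (P.swap.racahPoly P.M).eval (E j) *
        ∑ k ∈ Finset.range (P.M + 1), P.f k x * P.f k (E j) * P.weight k =
      ∏ l ∈ Finset.univ.erase j, (x - E l) := by
  rw [racahPoly_eq_orthPoly] at hE
  rw [hP.swap_racahPoly_eq_assocPoly, hP.sum_f_mul_f_mul_weight, ← eval_nodal,
    ← C_eval_assocPoly_mul_christoffelKernel (fun i hi => (hP.offDiag_pos hi).ne') hE,
    Polynomial.eval_mul, Polynomial.eval_C]

lemma sum_f_mul_f_mul_weight_of_ne {i j : ι} (hij : i ≠ j) :
    ∑ k ∈ Finset.range (P.M + 1), P.f k (E i) * P.f k (E j) * P.weight k = 0 := by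
  classical
  have hprod : ∏ l ∈ Finset.univ.erase j, (E i - E l) = 0 :=
    Finset.prod_eq_zero (Finset.mem_erase.mpr ⟨hij, Finset.mem_univ i⟩) (sub_self _)
  rw [← hP.eval_swap_racahPoly_mul_sum hE] at hprod
  exact (mul_eq_zero.mp hprod).resolve_left (hP.eval_swap_racahPoly_ne_zero hE j)

lemma sum_f_mul_f_mul_weight_self [DecidableEq ι] (j : ι) :
    ∑ k ∈ Finset.range (P.M + 1), P.f k (E j) * P.f k (E j) * P.weight k =
      1 / (|P.eps (E j)| * ∏ k ∈ Finset.Icc 1 P.M, P.a k) *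
        ∏ l ∈ Finset.univ.erase j, |E j - E l| := by
  have hpos : 0 < ∑ k ∈ Finset.range (P.M + 1), P.f k (E j) * P.f k (E j) * P.weight k := by
    rw [hP.sum_f_mul_f_mul_weight]
    exact eval_christoffelKernel_self_pos (fun i hi => hP.offDiag_pos hi) _
  rw [hP.abs_eps_mul_prod_a, ← Finset.abs_prod, ← hP.eval_swap_racahPoly_mul_sum hE, abs_mul,
    abs_of_pos hpos, one_div, inv_mul_cancel_left₀]
  exact abs_ne_zero.mpr (hP.eval_swap_racahPoly_ne_zero hE j)

end Admissible

end Parameters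

end EllipticRacah

theorem proposition3p4 (P : EllipticRacah.Parameters)
    (hp0 : 0 < P.p) (hp1 : P.p < 1)
    (hu1 : 0 < P.u 0) (hu2 : 0 < P.u 1)
    (hv1 : |P.v 0| < P.u 0 + 1 / 2) (hv2 : |P.v 1| < P.u 1 + 1 / 2)
    (hw : ∀ n : ℤ, P.w ≠ n * (2 * Real.pi / P.alpha))
    (hw1 : ∀ n : ℤ, P.w + 1 ≠ n * (2 * Real.pi / P.alpha)) :
    (∀ k ∈ Finset.Icc 1 P.M, 0 < P.a k ∧ 0 < P.aTilde k) ∧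
    ∃ E N : Fin (P.M + 1) → ℝ,
      StrictAnti E ∧ spectrum ℝ P.heunMatrix = Set.range E ∧
      (∀ j, P.eps (E j) ≠ 0) ∧
      (∀ i j, ∑ k ∈ Finset.range (P.M + 1), P.f k (E i) * P.f k (E j) * P.weight k =
        if i = j then N j else 0) ∧
      (∀ j, N j = 1 / (|P.eps (E j)| * ∏ k ∈ Finset.Icc 1 P.M, P.a k) *
        ∏ l ∈ Finset.univ.erase j, |E j - E l|) ∧
      (∀ j, N j = 1 / |P.eps (E j)| *
        (∏ k ∈ Finset.Icc 1 P.M, ∏ r : Fin 4,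
          P.bracket r (P.u 0 + k) / P.bracket r (P.u 0 - P.u r + k) *
          (P.bracket r (P.u 0 - 1 / 2 + k) / P.bracket r (P.u 0 - P.v r - 1 / 2 + k))) *
        ∏ l ∈ Finset.univ.erase j, |E j - E l|) := by
  have hP : P.Admissible := ⟨hp0, hp1, hu1, hu2, hv1, hv2⟩
  obtain ⟨E, hanti, hE⟩ := hP.exists_strictAnti_racahPoly_eq_nodal
  refine ⟨fun k hk => ⟨hP.a_pos hk, hP.aTilde_pos hk⟩, E, _, hanti,
    EllipticRacah.spectrum_eq_range_of_charpoly_eq_nodal hE, hP.eps_ne_zero hE,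
    fun i j => ?_, fun j => rfl, fun j => ?_⟩
  · split_ifs with hij
    · rw [hij, hP.sum_f_mul_f_mul_weight_self hE]
    · exact hP.sum_f_mul_f_mul_weight_of_ne hE hij
  · rw [hP.prod_bracket_eq_inv_prod_a, one_div, one_div, mul_inv]
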